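/- Let $M$ be a smooth $n$-dimensional Riemannian manifold with Levi-Civita connection $\overline\nabla$, let $\Sigma\subseteq M$ be a subset, and let $m\ge 0$ be an integer. Let $\Sigma_0\subseteq\Sigma$ be the set of points of $\Sigma$ near which $\Sigma$ is a twice differentiable embedded $m$-dimensional submanifold of $M$, i.e. which have a relatively open neighbourhood in $\Sigma$ that is the homeomorphic image of an open subset of $\mathbb R^m$ under a twice differentiable immersion. Call $\Sigma$ helicoidal in $M$ if for every $\bar p\in\Sigma$ there is a Riemannian isometry $\varphi$ of $M$ such that $$\varphi(\bar p)=\bar p,\qquad \varphi(\Sigma)=\Sigma,\qquad\text{and, if }\bar p\in\Sigma_0,\quad \varphi_*(v)=-v\ \text{ for every } v\in T_{\bar p}M \text{ with } v\perp T_{\bar p}\Sigma_0 .$$ (Neither completeness of $M$ nor any condition on the size of $\Sigma\setminus\Sigma_0$ is required.) If $\Sigma$ is helicoidal in $M$, then $\Sigma$ is minimal at every point of $\Sigma_0$: its mean curvature vector $$\vec H=\sum_{i=1}^m(\overline\nabla_{e_i}e_i)^\perp ,$$ the trace of the second fundamental form, where $e_1,\dots,e_m$ is a local orthonormal tangent frame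 of $\Sigma_0$ and $\perp$ denotes the component normal to $\Sigma_0$, vanishes at every point of $\Sigma_0$. -/

import Mathlib

open scoped Manifold ContDiff Topology Bundle

noncomputable section

namespace Helicoidal

variable {n : ℕ} {M : Type*} [TopologicalSpace M] [ChartedSpace (EuclideanSpace ℝ (Fin n)) M]

section Submanifold

/-- A local parametrization of the subset `S ⊆ M` as a twice differentiable embedded
`m`-dimensional submanifold: a twice differentiable immersion of an open subset `domain` of `ℝᵐ`
that is a homeomorphism onto a relatively open subset of `S`. -/
structure LocalParametrization (S : Set M) (m : ℕ) where
  /-- the open set of parameters -/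
  domain : Set (EuclideanSpace ℝ (Fin m))
  /-- the parametrization; only its values on `domain` matter -/
  toFun : EuclideanSpace ℝ (Fin m) → M
  isOpen_domain : IsOpen domain
  mdifferentiableOn : MDifferentiableOn (𝓡 m) (𝓡 n) toFun domain
  /-- in local coordinates the first derivative is differentiable at every point of `domain` -/
  differentiableAt_fderiv : ∀ x ∈ domain,
    DifferentiableAt ℝ (fderiv ℝ (extChartAt (𝓡 n) (toFun x) ∘ toFun)) x
  injective_mfderiv : ∀ x ∈ domain, Function.Injective (mfderiv (𝓡 m) (𝓡 n) toFun x)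
  isEmbedding : Topology.IsEmbedding (domain.domRestrict toFun)
  image_eq : ∃ W : Set M, IsOpen W ∧ toFun '' domain = S ∩ W

/-- The tangent space at `f x` of the submanifold parametrized by `f`, namely the image of
`df_x`. -/
def tangentSubspace {m : ℕ} (f : EuclideanSpace ℝ (Fin m) → M) (x : EuclideanSpace ℝ (Fin m)) :
    Submodule ℝ (TangentSpace (𝓡 n) (f x)) :=
  (mfderiv (𝓡 m) (𝓡 n) f x).range

/-- The regular part of `S`: the points of `S` near which `S` is a twice differentiable embedded
`m`-dimensional submanifold of `M`. -/
def regularPart (S : Set M) (m : ℕ) : Set M :=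
  {p | ∃ P : LocalParametrization (n := n) S m, ∃ x ∈ P.domain, P.toFun x = p}

end Submanifold

variable [IsManifold (𝓡 n) ∞ M] [Bundle.RiemannianBundle (fun p : M ↦ TangentSpace (𝓡 n) p)]

section LeviCivita

/-- The matrix `g_{ij}` of the Riemannian metric in the preferred chart at `p`, at the point with
coordinates `y`. -/
def chartMetric (p : M) (y : EuclideanSpace ℝ (Fin n)) : Matrix (Fin n) (Fin n) ℝ :=
  Matrix.of fun i j ↦ inner ℝ
    (mfderiv (𝓡 n) (𝓡 n) (extChartAt (𝓡 n) p).symm y (EuclideanSpace.single i (1 : ℝ)))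
    (mfderiv (𝓡 n) (𝓡 n) (extChartAt (𝓡 n) p).symm y (EuclideanSpace.single j (1 : ℝ)))

/-- The partial derivative `∂_k g_{ij}` in the preferred chart at `p`. -/
def chartMetricDeriv (p : M) (y : EuclideanSpace ℝ (Fin n)) (k i j : Fin n) : ℝ :=
  fderiv ℝ (fun z ↦ chartMetric p z i j) y (EuclideanSpace.single k (1 : ℝ))

/-- The Christoffel symbol
`Γᵏᵢⱼ = ½ ∑ₗ gᵏˡ (∂ᵢ gⱼₗ + ∂ⱼ gᵢₗ - ∂ₗ gᵢⱼ)` of the Levi-Civita connection in the preferred chart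
at `p`. -/
def christoffelSymbol (p : M) (y : EuclideanSpace ℝ (Fin n)) (k i j : Fin n) : ℝ :=
  (1 / 2 : ℝ) * ∑ l, (chartMetric p y)⁻¹ k l *
    (chartMetricDeriv p y i j l + chartMetricDeriv p y j i l - chartMetricDeriv p y l i j)

/-- The Christoffel symbols as the bilinear expression `(∑ᵢⱼ Γᵏᵢⱼ uⁱ vʲ)ₖ`. -/
def christoffel (p : M) (y u v : EuclideanSpace ℝ (Fin n)) : EuclideanSpace ℝ (Fin n) :=
  WithLp.toLp 2 fun k ↦ ∑ i, ∑ j, christoffelSymbol p y k i j * u i * v j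

/-- The Levi-Civita covariant derivative `∇_a Y` at the parameter `x` of a vector field `Y` along a
map `f : ℝᵐ → M`. In the preferred chart at `f x` it is `∂_a Y + Γ(df a, Y)`; the inverse of the
differential of the chart turns this coordinate vector into a tangent vector at `f x`. -/
def covariantDerivAlong {m : ℕ} (f : EuclideanSpace ℝ (Fin m) → M)
    (Y : ∀ z, TangentSpace (𝓡 n) (f z)) (x a : EuclideanSpace ℝ (Fin m)) :
    TangentSpace (𝓡 n) (f x) :=
  let ψ := extChartAt (𝓡 n) (f x)
  let Ycoord : EuclideanSpace ℝ (Fin m) → EuclideanSpace ℝ (Fin n) :=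
    fun z ↦ mfderiv (𝓡 n) (𝓡 n) ψ (f z) (Y z)
  (mfderiv (𝓡 n) (𝓡 n) ψ (f x)).inverse
    (fderiv ℝ Ycoord x a + christoffel (f x) (ψ (f x)) (fderiv ℝ (ψ ∘ f) x a) (Ycoord x))

end LeviCivita

section MeanCurvature

instance (p : M) : FiniteDimensional ℝ (TangentSpace (𝓡 n) p) :=
  inferInstanceAs (FiniteDimensional ℝ (EuclideanSpace ℝ (Fin n)))

/-- The second fundamental form `(∇_a (df b))^⊥` of the immersion `f` at `x`, evaluated on
`df_x a` and `df_x b`. -/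
def secondFundamentalForm {m : ℕ} (f : EuclideanSpace ℝ (Fin m) → M)
    (x a b : EuclideanSpace ℝ (Fin m)) : TangentSpace (𝓡 n) (f x) :=
  (tangentSubspace (n := n) f x)ᗮ.starProjection
    (covariantDerivAlong (n := n) f (fun z ↦ mfderiv (𝓡 m) (𝓡 n) f z b) x a)

/-- The matrix `h_{ij} = ⟨∂ᵢ f, ∂ⱼ f⟩` of the metric induced by `f`. -/
def inducedMetric {m : ℕ} (f : EuclideanSpace ℝ (Fin m) → M) (x : EuclideanSpace ℝ (Fin m)) :
    Matrix (Fin m) (Fin m) ℝ :=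
  Matrix.of fun i j ↦ inner ℝ
    (mfderiv (𝓡 m) (𝓡 n) f x (EuclideanSpace.single i (1 : ℝ)))
    (mfderiv (𝓡 m) (𝓡 n) f x (EuclideanSpace.single j (1 : ℝ)))

/-- The mean curvature vector at `f x`: the trace `∑ᵢⱼ hⁱʲ II(∂ᵢ f, ∂ⱼ f)` of the second
fundamental form with respect to the induced metric. It equals `∑ᵢ (∇_{eᵢ} eᵢ)^⊥` for every local
orthonormal tangent frame `eᵢ`. -/
def meanCurvatureVector {m : ℕ} (f : EuclideanSpace ℝ (Fin m) → M)
    (x : EuclideanSpace ℝ (Fin m)) : TangentSpace (𝓡 n) (f x) :=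
  ∑ i, ∑ j, (inducedMetric (n := n) f x)⁻¹ i j •
    secondFundamentalForm (n := n) f x (EuclideanSpace.single i 1) (EuclideanSpace.single j 1)

end MeanCurvature

/-- A diffeomorphism of `M` is an isometry if its differential preserves the Riemannian metric. -/
def IsRiemannianIsometry (φ : M ≃ₘ⟮𝓡 n, 𝓡 n⟯ M) : Prop :=
  ∀ (p : M) (v w : TangentSpace (𝓡 n) p),
    inner ℝ (mfderiv (𝓡 n) (𝓡 n) φ p v) (mfderiv (𝓡 n) (𝓡 n) φ p w) = inner ℝ v w

/-- `S` is helicoidal (as an `m`-dimensional subset of `M`): for each `p ∈ S` some isometry `φ` of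
`M` fixes `p`, maps `S` onto itself and satisfies `φ_* v = -v` for each `v` normal at `p` to the
regular part of `S`. The last condition concerns only regular points `p`, since there is
no tangent space at the others. The regular part is not required to have full measure in `S`. -/
def IsHelicoidal (S : Set M) (m : ℕ) : Prop :=
  ∀ p ∈ S, ∃ φ : M ≃ₘ⟮𝓡 n, 𝓡 n⟯ M, IsRiemannianIsometry φ ∧ φ p = p ∧ φ '' S = S ∧
    ∀ (P : LocalParametrization (n := n) S m), ∀ x ∈ P.domain, P.toFun x = p →
      ∀ v ∈ (tangentSubspace (n := n) P.toFun x)ᗮ,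
        tangentMap (𝓡 n) (𝓡 n) φ ⟨P.toFun x, v⟩ = ⟨P.toFun x, -v⟩

/-- `S` is minimal at `p`: the mean curvature vector of `S` at `p` vanishes (computed in any local
parametrization of `S` near `p`). -/
def IsMinimalAt (S : Set M) (m : ℕ) (p : M) : Prop :=
  ∀ (P : LocalParametrization (n := n) S m), ∀ x ∈ P.domain, P.toFun x = p →
    meanCurvatureVector (n := n) P.toFun x = 0

end Helicoidal

end

/-! At a regular point `p = f x`, let `φ` be the isometry of the definition. As `φ` preserves `S`,
it induces a map `θ` of parameters with `f ∘ θ = φ ∘ f` near `x`; its differential `A` at `x`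
preserves the induced metric. For normal `w`, naturality of the second fundamental form gives `⟨w,
II(A h, A h)⟩ = ⟨w, dφ II(h, h)⟩ = -⟨w, II(h, h)⟩`, because `dφ w = -w`. The trace of `⟨w, II⟩` is
therefore its own negative, so `⟨w, H⟩ = 0`; take `w = H`.

The difficulty is regularity: `f` is only twice differentiable and `θ` is a priori only continuous
at `x`. `hasFDerivAt_of_comp_immersion` yields one derivative of `θ` at `x`. A second one is not
needed: the normal component of `f` in coordinates is critical at `x`, and at a critical point the
Hessian pulls back under a once differentiable map (`second_derivative_comp_of_critical`).
`normal_hessian_neg` combines this with the transformation law of the Christoffel symbols, and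
`gram_trace_eq_zero` is the linear algebra of the trace. -/

noncomputable section

namespace Helicoidal

/-! ### Calculus of twice differentiable maps at a point. -/

section Calculus

variable {V W : Type*} [NormedAddCommGroup V] [NormedSpace ℝ V]
  [NormedAddCommGroup W] [NormedSpace ℝ W]

/-- Second order Taylor expansion at a critical point of a function that is twice differentiable
there. -/
lemma isLittleO_taylor_two {r : V → ℝ} {r' : V → V →L[ℝ] ℝ} {r'' : V →L[ℝ] V →L[ℝ] ℝ} {x : V}
    (hr : ∀ᶠ z in 𝓝 x, HasFDerivAt r (r' z) z) (hr' : HasFDerivAt r' r'' x) (h0 : r' x = 0) :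
    (fun z ↦ r z - r x - r'' (z - x) (z - x) / 2) =o[𝓝 x] fun z ↦ ‖z - x‖ ^ 2 := by
  have hsymm : ∀ u v, r'' u v = r'' v u :=
    second_derivative_symmetric_of_eventually hr hr'
  rw [Asymptotics.isLittleO_iff]
  intro ε hε
  have h1 := (Asymptotics.isLittleO_iff.1 hr'.isLittleO) hε
  obtain ⟨δ, hδ, hball⟩ := Metric.eventually_nhds_iff_ball.1 (hr.and h1)
  filter_upwards [Metric.ball_mem_nhds x hδ] with z hz
  -- By symmetry of `r''`, the derivative of `k` at `y` is `r' y - r'' (y - x)`, which is at most `ε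
  -- * ‖y - x‖` on the ball; the mean value inequality on the segment then suffices.
  set k : V → ℝ := fun z ↦ r z - r'' (z - x) (z - x) / 2 with hk
  have hkd : ∀ y ∈ Metric.ball x δ, HasFDerivAt k (r' y - r'' (y - x)) y := by
    intro y hy
    have hsub : HasFDerivAt (fun z ↦ z - x) (ContinuousLinearMap.id ℝ V) y :=
      (hasFDerivAt_id y).sub_const x
    have h2 := ((r''.hasFDerivAt.comp y hsub).clm_apply hsub)
    have h3 := ((hball y hy).1).sub (h2.mul_const (2⁻¹ : ℝ))
    refine (h3.congr_fderiv ?_).congr_of_eventuallyEq (Filter.Eventually.of_forall fun z ↦ ?_)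
    · ext v
      simp [hsymm v]
      ring
    · simp [hk, div_eq_mul_inv]
  have hsub : segment ℝ x z ⊆ Metric.ball x δ ∩ Metric.closedBall x ‖z - x‖ := by
    refine (((convex_ball x δ).inter (convex_closedBall x _)).segment_subset ?_ ?_)
    · exact ⟨Metric.mem_ball_self hδ, Metric.mem_closedBall_self (norm_nonneg _)⟩
    · exact ⟨hz, by simp [dist_eq_norm]⟩
  have hmv := (convex_segment x z).norm_image_sub_le_of_norm_hasFDerivWithin_le (f := k)
    (f' := fun y ↦ r' y - r'' (y - x)) (C := ε * ‖z - x‖)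
    (fun y hy ↦ (hkd y (hsub hy).1).hasFDerivWithinAt)
    (fun y hy ↦ by
      have := (hball y (hsub hy).1).2
      rw [h0, sub_zero] at this
      refine this.trans ?_
      gcongr
      simpa [dist_eq_norm] using (hsub hy).2)
    (left_mem_segment ℝ x z) (right_mem_segment ℝ x z)
  have e : k z - k x = r z - r x - r'' (z - x) (z - x) / 2 := by
    simp [hk]; ring
  rw [e] at hmv
  simpa [pow_two, mul_assoc] using hmv

/-- Since `r' x = 0`, only the velocity of `c` enters at second order, so one derivative of `c` at
`0` is enough. -/
lemma tendsto_taylor_two_along {r : V → ℝ} {r' : V → V →L[ℝ] ℝ} {r'' : V →L[ℝ] V →L[ℝ] ℝ} {x : V}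
    (hr : ∀ᶠ z in 𝓝 x, HasFDerivAt r (r' z) z) (hr' : HasFDerivAt r' r'' x) (h0 : r' x = 0)
    {c : ℝ → V} {v : V} (hc : HasDerivAt c v 0) (hc0 : c 0 = x) :
    Filter.Tendsto (fun t ↦ (r (c t) - r x) / t ^ 2) (𝓝[≠] 0) (𝓝 (r'' v v / 2)) := by
  have hct : Filter.Tendsto c (𝓝[≠] 0) (𝓝 x) := by
    have := hc.continuousAt.tendsto
    rw [hc0] at this
    exact this.mono_left nhdsWithin_le_nhds
  have hslope : Filter.Tendsto (fun t ↦ t⁻¹ • (c t - x)) (𝓝[≠] 0) (𝓝 v) := by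
    have := hasDerivAt_iff_tendsto_slope.1 hc
    refine this.congr fun t ↦ ?_
    simp [slope, hc0]
  have hO : (fun t ↦ ‖c t - x‖ ^ 2) =O[𝓝[≠] 0] fun t : ℝ ↦ t ^ 2 := by
    have h := hc.isBigO_sub
    simp only [hc0, sub_zero] at h
    exact (h.norm_left.pow 2).mono nhdsWithin_le_nhds
  have ho := (((isLittleO_taylor_two hr hr' h0).comp_tendsto hct).trans_isBigO hO).tendsto_div_nhds_zero
  have hq : Filter.Tendsto (fun t ↦ r'' (t⁻¹ • (c t - x)) (t⁻¹ • (c t - x)) / 2) (𝓝[≠] 0)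
      (𝓝 (r'' v v / 2)) := by
    have hcont : Continuous fun w ↦ r'' w w / 2 := by fun_prop
    exact (hcont.tendsto v).comp hslope
  have := ho.add hq
  rw [zero_add] at this
  refine this.congr' ?_
  filter_upwards [self_mem_nhdsWithin] with t ht
  have ht : t ≠ 0 := ht
  simp only [Function.comp_apply, map_smul, smul_apply, smul_eq_mul]
  field_simp
  ring

/-- At a common critical point, the second derivative of `r ∘ θ` is the pull-back of that of `r` by
the first derivative of `θ`, even if `θ` is differentiable only once. -/
lemma second_derivative_comp_of_critical {r s : V → ℝ} {r' s' : V → V →L[ℝ] ℝ}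
    {r'' s'' : V →L[ℝ] V →L[ℝ] ℝ} {x : V} {θ : V → V} {A : V →L[ℝ] V}
    (hr : ∀ᶠ z in 𝓝 x, HasFDerivAt r (r' z) z) (hr' : HasFDerivAt r' r'' x) (hr0 : r' x = 0)
    (hs : ∀ᶠ z in 𝓝 x, HasFDerivAt s (s' z) z) (hs' : HasFDerivAt s' s'' x) (hs0 : s' x = 0)
    (hθ : HasFDerivAt θ A x) (hθx : θ x = x) (hrs : ∀ᶠ z in 𝓝 x, r (θ z) = s z) (h : V) :
    s'' h h = r'' (A h) (A h) := by
  have hline : HasDerivAt (fun t : ℝ ↦ x + t • h) h 0 := by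
    simpa using ((hasDerivAt_id (0 : ℝ)).smul_const h).const_add x
  have hline0 : x + (0 : ℝ) • h = x := by simp
  have hcomp : HasDerivAt (fun t : ℝ ↦ θ (x + t • h)) (A h) 0 := by
    have hθ2 : HasFDerivAt θ A (x + (0 : ℝ) • h) := by rwa [hline0]
    exact hθ2.comp_hasDerivAt (0 : ℝ) hline
  -- Both limits are of the same quotient: `s` along the line, and `r` along its image under `θ`, a
  -- curve of velocity `A h`.
  have h1 := tendsto_taylor_two_along hs hs' hs0 hline hline0
  have h2 := tendsto_taylor_two_along hr hr' hr0 hcomp (by simp [hθx])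
  have h3 : ∀ᶠ t in 𝓝[≠] (0 : ℝ), r (θ (x + t • h)) = s (x + t • h) := by
    have ht := hline.continuousAt.tendsto
    rw [hline0] at ht
    exact (ht.eventually hrs).filter_mono nhdsWithin_le_nhds
  have hx : r x = s x := by simpa [hθx] using hrs.self_of_nhds
  have h4 := tendsto_nhds_unique h1 (h2.congr' (by
    filter_upwards [h3] with t ht
    rw [ht, hx]))
  linarith

/-- If `F ∘ θ` is differentiable at a fixed point `x` of the continuous map `θ` and `F` is an
immersion at `x`, then `θ` is differentiable at `x`. -/
lemma hasFDerivAt_of_comp_immersion {F : V → W} {F' : V →L[ℝ] W} {H' : V →L[ℝ] W} {L : W →L[ℝ] V}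
    {x : V} {θ : V → V} (hF : HasFDerivAt F F' x) (hL : ∀ v, L (F' v) = v)
    (hH : HasFDerivAt (fun z ↦ F (θ z)) H' x) (hθ : ContinuousAt θ x) (hθx : θ x = x) :
    HasFDerivAt θ (L.comp H') x := by
  have ht : Filter.Tendsto θ (𝓝 x) (𝓝 x) := by
    have := hθ.tendsto; rwa [hθx] at this
  have h1 : (fun z ↦ F (θ z) - F x - F' (θ z - x)) =o[𝓝 x] fun z ↦ θ z - x :=
    hF.isLittleO.comp_tendsto ht
  have h2 : (fun z ↦ L (F (θ z) - F x) - (θ z - x)) =o[𝓝 x] fun z ↦ θ z - x := by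
    refine ((L.isBigO_comp _ _).trans_isLittleO h1).congr_left fun z ↦ ?_
    rw [map_sub, hL]
  have h3 : (fun z ↦ L (F (θ z) - F x)) =O[𝓝 x] fun z ↦ z - x := by
    have := hH.isBigO_sub
    simp only [hθx] at this
    exact (L.isBigO_comp _ _).trans this
  -- The error in `h2` is small relative to `θ z - x` itself, so it can be absorbed.
  have h4 : (fun z ↦ θ z - x) =O[𝓝 x] fun z ↦ z - x := by
    have h5 : (fun z ↦ θ z - x) =O[𝓝 x] fun z ↦ L (F (θ z) - F x) := by
      simpa using h2.right_isBigO_add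
    exact h5.trans h3
  refine HasFDerivAt.of_isLittleO ?_
  have h6 := h2.trans_isBigO h4
  have h7 : (fun z ↦ L (F (θ z) - F x - H' (z - x))) =o[𝓝 x] fun z ↦ z - x := by
    have := hH.isLittleO
    simp only [hθx] at this
    exact (L.isBigO_comp _ _).trans_isLittleO this
  refine (h7.sub h6).congr_left fun z ↦ ?_
  simp only [map_sub, hθx, ContinuousLinearMap.comp_apply]
  abel

set_option synthInstance.maxHeartbeats 200000 in
/-- The transformation law of the Christoffel symbols of the first kind under a local isometry that
fixes `y`. -/
lemma christoffel_transformation {G : V → V →L[ℝ] V →L[ℝ] ℝ} {G' : V →L[ℝ] V →L[ℝ] V →L[ℝ] ℝ}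
    {Φ : V → V} {Φ' : V → V →L[ℝ] V} {Φ'' : V →L[ℝ] V →L[ℝ] V} {y : V}
    (hG : HasFDerivAt G G' y) (hGsymm : ∀ z u v, G z u v = G z v u)
    (hΦ : ∀ᶠ z in 𝓝 y, HasFDerivAt Φ (Φ' z) z) (hΦ' : HasFDerivAt Φ' Φ'' y) (hy : Φ y = y)
    (hiso : ∀ᶠ z in 𝓝 y, ∀ u v, G (Φ z) (Φ' z u) (Φ' z v) = G z u v) (u w : V) :
    2 * G y (Φ' y w) (Φ'' u u) + (2 * G' (Φ' y u) (Φ' y u) (Φ' y w) - G' (Φ' y w) (Φ' y u) (Φ' y u))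
      = 2 * G' u u w - G' w u u := by
  have hsymm : ∀ u v, Φ'' u v = Φ'' v u := second_derivative_symmetric_of_eventually hΦ hΦ'
  have hG2 : HasFDerivAt (fun z ↦ G (Φ z)) (G'.comp (Φ' y)) y := by
    have : HasFDerivAt G G' (Φ y) := by rwa [hy]
    exact HasFDerivAt.comp (g := G) (f := Φ) (g' := G') (f' := Φ' y) y this hΦ.self_of_nhds
  -- The isometry identity differentiated in the direction `c`.
  have key : ∀ a b c, G' (Φ' y c) (Φ' y a) (Φ' y b) + G y (Φ'' c a) (Φ' y b)
      + G y (Φ' y a) (Φ'' c b) = G' c a b := by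
    intro a b c
    have hL := (hG2.clm_apply (hΦ'.clm_apply (hasFDerivAt_const a y))).clm_apply
      (hΦ'.clm_apply (hasFDerivAt_const b y))
    have hR := (hG.clm_apply (hasFDerivAt_const a y)).clm_apply (hasFDerivAt_const b y)
    have hLR := hL.unique (hR.congr_of_eventuallyEq (by
      filter_upwards [hiso] with z hz using hz a b))
    have := DFunLike.congr_fun hLR c
    simp [hy] at this
    linarith
  have hG's : ∀ c a b, G' c a b = G' c b a := by
    intro c a b
    have h1 := (hG.clm_apply (hasFDerivAt_const a y)).clm_apply (hasFDerivAt_const b y)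
    have h2 := (hG.clm_apply (hasFDerivAt_const b y)).clm_apply (hasFDerivAt_const a y)
    have := DFunLike.congr_fun (h1.unique (h2.congr_of_eventuallyEq (by
      filter_upwards with z using hGsymm z a b))) c
    simpa using this
  -- In `2 * k1 - k2` the mixed terms `Φ'' u w` cancel, as in Koszul's formula.
  have k1 := key u w u
  have k2 := key u u w
  rw [hsymm w u, hGsymm y (Φ'' u w)] at k2
  rw [hGsymm y (Φ'' u u)] at k1
  linarith

lemma fderiv_apply_const {g : V → V →L[ℝ] W} {x : V} (hg : DifferentiableAt ℝ g x) (a b : V) :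
    fderiv ℝ (fun z ↦ g z b) x a = fderiv ℝ g x a b := by
  rw [(hg.hasFDerivAt.clm_apply (hasFDerivAt_const b x)).fderiv]
  simp

end Calculus

/-! ### Traces of quadratic forms reversed by an isometry. -/

section Trace

open Matrix

/-- If `A` preserves the nondegenerate symmetric form `K` and reverses the sign of the quadratic
form `Q`, then the trace of `Q` with respect to `K` vanishes. -/
lemma trace_eq_zero_of_isometry_neg {ι : Type*} [Fintype ι] [DecidableEq ι] {K Q A : Matrix ι ι ℝ}
    (hK : IsUnit K.det) (hKs : Kᵀ = K) (hA : Aᵀ * K * A = K)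
    (hQ : ∀ v, (A *ᵥ v) ⬝ᵥ Q *ᵥ (A *ᵥ v) = -(v ⬝ᵥ Q *ᵥ v)) :
    ∑ i, ∑ j, K⁻¹ i j * Q i j = 0 := by
  -- `hQ` only sees the symmetric part of `Q`; polarization needs a symmetric matrix.
  set R := Q + Qᵀ with hR
  have hdot : ∀ (B : Matrix ι ι ℝ) v w, v ⬝ᵥ Bᵀ *ᵥ w = w ⬝ᵥ B *ᵥ v := by
    intro B v w
    rw [Matrix.mulVec_transpose, dotProduct_comm, ← Matrix.dotProduct_mulVec]
  have hRs : Rᵀ = R := by simp [hR, add_comm]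
  have hRq : ∀ v, (A *ᵥ v) ⬝ᵥ R *ᵥ (A *ᵥ v) = -(v ⬝ᵥ R *ᵥ v) := by
    intro v
    simp only [hR, Matrix.add_mulVec, dotProduct_add, hdot, hQ]
    ring
  have hRA : Aᵀ * R * A = -R := by
    set T := Aᵀ * R * A + R with hT
    have hTs : Tᵀ = T := by simp [hT, Matrix.transpose_mul, hRs, Matrix.mul_assoc]
    have hTq : ∀ v, v ⬝ᵥ T *ᵥ v = 0 := by
      intro v
      have : v ⬝ᵥ (Aᵀ * R * A) *ᵥ v = (A *ᵥ v) ⬝ᵥ R *ᵥ (A *ᵥ v) := by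
        rw [← Matrix.mulVec_mulVec, ← Matrix.mulVec_mulVec, Matrix.dotProduct_mulVec,
          Matrix.vecMul_transpose]
      rw [hT, Matrix.add_mulVec, dotProduct_add, this, hRq]
      ring
    have hT0 : T = 0 := by
      ext i j
      have h1 := hTq (Pi.single i 1 + Pi.single j 1)
      have h2 := hTq (Pi.single i 1)
      have h3 := hTq (Pi.single j 1)
      have h4 : T j i = T i j := congrFun (congrFun hTs i) j
      simp only [Matrix.mulVec_add, dotProduct_add, add_dotProduct, Matrix.mulVec_single_one,
        single_one_dotProduct, Matrix.col_apply] at h1 h2 h3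
      simp only [Matrix.zero_apply]
      linarith
    rw [hT] at hT0
    exact eq_neg_of_add_eq_zero_left hT0
  -- By `hA`, `K⁻¹ * Aᵀ * K` is a left inverse of the square matrix `A`, hence also a right inverse.
  have hKinv : A * K⁻¹ * Aᵀ = K⁻¹ := by
    have h1 : K⁻¹ * Aᵀ * K * A = 1 := by
      rw [Matrix.mul_assoc, Matrix.mul_assoc, ← Matrix.mul_assoc Aᵀ, hA,
        Matrix.nonsing_inv_mul _ hK]
    have h2 : A * (K⁻¹ * Aᵀ * K) = 1 := mul_eq_one_comm.1 h1
    calc A * K⁻¹ * Aᵀ = A * (K⁻¹ * Aᵀ * K) * K⁻¹ := by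
          simp only [Matrix.mul_assoc, Matrix.mul_nonsing_inv _ hK, Matrix.mul_one]
      _ = K⁻¹ := by rw [h2, Matrix.one_mul]
  have hKis : (K⁻¹)ᵀ = K⁻¹ := by rw [Matrix.transpose_nonsing_inv, hKs]
  -- Cyclicity of the trace moves `A` from `K⁻¹` onto `R`, which changes the sign.
  have htr : (K⁻¹ * R).trace = 0 := by
    have : (K⁻¹ * R).trace = -(K⁻¹ * R).trace := by
      calc (K⁻¹ * R).trace = (A * K⁻¹ * Aᵀ * R).trace := by rw [hKinv]
        _ = (K⁻¹ * (Aᵀ * R * A)).trace := by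
            rw [Matrix.mul_assoc, Matrix.mul_assoc, Matrix.trace_mul_comm]
            simp only [Matrix.mul_assoc]
        _ = -(K⁻¹ * R).trace := by rw [hRA, Matrix.mul_neg, Matrix.trace_neg]
    linarith
  have hsum : ∑ i, ∑ j, K⁻¹ i j * Q i j = (K⁻¹ * Qᵀ).trace := by
    simp [Matrix.trace, Matrix.mul_apply]
  have h5 : (K⁻¹ * Q).trace = (K⁻¹ * Qᵀ).trace := by
    rw [← Matrix.trace_transpose, Matrix.transpose_mul, hKis, Matrix.trace_mul_comm]
  rw [hR, Matrix.mul_add, Matrix.trace_add, h5] at htr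
  rw [hsum]
  linarith

end Trace

/-! ### Gram matrices of linear maps on Euclidean space. -/

section Gram

variable {k : ℕ} {X : Type*} [NormedAddCommGroup X] [InnerProductSpace ℝ X]

lemma euclidean_sum_smul_single (u : EuclideanSpace ℝ (Fin k)) :
    ∑ i, u i • EuclideanSpace.single i (1 : ℝ) = u := by
  ext j
  simp [Finset.sum_apply, Pi.single_apply]

lemma sum_gram_mul (L : EuclideanSpace ℝ (Fin k) →ₗ[ℝ] X) (u v : EuclideanSpace ℝ (Fin k)) :
    ∑ i, ∑ j, inner ℝ (L (EuclideanSpace.single i (1 : ℝ))) (L (EuclideanSpace.single j (1 : ℝ)))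
      * u i * v j = inner ℝ (L u) (L v) := by
  conv_rhs => rw [← euclidean_sum_smul_single u, ← euclidean_sum_smul_single v]
  simp only [map_sum, map_smul, sum_inner, inner_sum, real_inner_smul_left, real_inner_smul_right]
  rw [Finset.sum_comm]
  refine Finset.sum_congr rfl fun i _ ↦ Finset.sum_congr rfl fun j _ ↦ ?_
  ring

/-- A kernel vector `v` of the Gram matrix satisfies `‖L v‖² = 0`. -/
lemma isUnit_det_gram (L : EuclideanSpace ℝ (Fin k) →ₗ[ℝ] X) (hL : Function.Injective L) :
    IsUnit (Matrix.of fun i j : Fin k ↦ inner ℝ (L (EuclideanSpace.single i (1 : ℝ)))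
      (L (EuclideanSpace.single j (1 : ℝ)))).det := by
  rw [isUnit_iff_ne_zero]
  intro h
  obtain ⟨v, hv, h0⟩ := Matrix.exists_mulVec_eq_zero_iff.2 h
  apply hv
  have h1 : inner ℝ (L (WithLp.toLp 2 v)) (L (WithLp.toLp 2 v)) = 0 := by
    rw [← sum_gram_mul]
    refine Finset.sum_eq_zero fun i _ ↦ ?_
    have := congrFun h0 i
    simp only [Matrix.mulVec, dotProduct, Matrix.of_apply, Pi.zero_apply] at this
    calc _ = v i * ∑ j, inner ℝ (L (EuclideanSpace.single i (1 : ℝ)))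
          (L (EuclideanSpace.single j (1 : ℝ))) * v j := by
          rw [Finset.mul_sum]
          exact Finset.sum_congr rfl fun j _ ↦ by ring
      _ = 0 := by rw [this, mul_zero]
  have h2 : WithLp.toLp 2 v = (0 : EuclideanSpace ℝ (Fin k)) :=
    hL (by rw [map_zero]; exact inner_self_eq_zero.1 h1)
  simpa using congrArg (WithLp.ofLp) h2

lemma differentiableAt_sum_smul {V Y : Type*} [NormedAddCommGroup V] [NormedSpace ℝ V]
    [NormedAddCommGroup Y] [NormedSpace ℝ Y] {g : V → Matrix (Fin k) (Fin k) ℝ} {y : V}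
    (hg : ∀ i j, DifferentiableAt ℝ (fun z ↦ g z i j) y) (B : Fin k → Fin k → Y) :
    DifferentiableAt ℝ (fun z ↦ ∑ i, ∑ j, g z i j • B i j) y :=
  DifferentiableAt.fun_sum fun i _ ↦ DifferentiableAt.fun_sum fun j _ ↦ (hg i j).smul_const _

end Gram

/-! ### Differentials of the preferred charts. -/

section ChartDerivative

variable {n : ℕ} {M : Type*} [TopologicalSpace M] [ChartedSpace (EuclideanSpace ℝ (Fin n)) M]
  [IsManifold (𝓡 n) ∞ M] {p q : M}

lemma mdifferentiableAt_extChartAt_of_mem_source (hq : q ∈ (extChartAt (𝓡 n) p).source) :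
    MDifferentiableAt (𝓡 n) (𝓡 n) (extChartAt (𝓡 n) p) q := by
  have : IsManifold (𝓡 n) 1 M := IsManifold.of_le (n := ∞) (by norm_cast)
  exact mdifferentiableAt_extChartAt (by simpa using hq)

lemma mdifferentiableAt_extChartAt_symm_of_mem_target {y : EuclideanSpace ℝ (Fin n)}
    (hy : y ∈ (extChartAt (𝓡 n) p).target) :
    MDifferentiableAt (𝓡 n) (𝓡 n) (extChartAt (𝓡 n) p).symm y := by
  have : IsManifold (𝓡 n) 1 M := IsManifold.of_le (n := ∞) (by norm_cast)
  have := mdifferentiableWithinAt_extChartAt_symm (I := 𝓡 n) (x := p) hy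
  rwa [ModelWithCorners.range_eq_univ, mdifferentiableWithinAt_univ] at this

/-- The differential at `q` of the preferred chart at `p`. -/
def chartDeriv (p q : M) : TangentSpace (𝓡 n) q →L[ℝ] EuclideanSpace ℝ (Fin n) :=
  mfderiv (𝓡 n) (𝓡 n) (extChartAt (𝓡 n) p) q

/-- The differential at `y` of the inverse of the preferred chart at `p`. -/
def chartSymmDeriv (p : M) (y : EuclideanSpace ℝ (Fin n)) :
    EuclideanSpace ℝ (Fin n) →L[ℝ] TangentSpace (𝓡 n) ((extChartAt (𝓡 n) p).symm y) :=
  mfderiv (𝓡 n) (𝓡 n) (extChartAt (𝓡 n) p).symm y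

lemma chartDeriv_chartSymmDeriv {y : EuclideanSpace ℝ (Fin n)}
    (hy : y ∈ (extChartAt (𝓡 n) p).target) (u : EuclideanSpace ℝ (Fin n)) :
    chartDeriv p ((extChartAt (𝓡 n) p).symm y) (chartSymmDeriv p y u) = u := by
  have : IsManifold (𝓡 n) 1 M := IsManifold.of_le (n := ∞) (by norm_cast)
  have := mfderiv_extChartAt_comp_mfderivWithin_extChartAt_symm (I := 𝓡 n) (x := p) hy
  rw [ModelWithCorners.range_eq_univ, mfderivWithin_univ] at this
  exact DFunLike.congr_fun this u

lemma chartSymmDeriv_chartDeriv {y : EuclideanSpace ℝ (Fin n)}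
    (hy : y ∈ (extChartAt (𝓡 n) p).target)
    (v : TangentSpace (𝓡 n) ((extChartAt (𝓡 n) p).symm y)) :
    chartSymmDeriv p y (chartDeriv p ((extChartAt (𝓡 n) p).symm y) v) = v := by
  have : IsManifold (𝓡 n) 1 M := IsManifold.of_le (n := ∞) (by norm_cast)
  have := mfderivWithin_extChartAt_symm_comp_mfderiv_extChartAt (I := 𝓡 n) (x := p) hy
  rw [ModelWithCorners.range_eq_univ, mfderivWithin_univ] at this
  exact DFunLike.congr_fun this v

lemma chartDeriv_inverse_apply (hq : q ∈ (extChartAt (𝓡 n) p).source)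
    (u : EuclideanSpace ℝ (Fin n)) : chartDeriv p q ((chartDeriv p q).inverse u) = u := by
  have : IsManifold (𝓡 n) 1 M := IsManifold.of_le (n := ∞) (by norm_cast)
  exact (isInvertible_mfderiv_extChartAt (I := 𝓡 n) hq).self_apply_inverse u

lemma chartDeriv_injective (hq : q ∈ (extChartAt (𝓡 n) p).source) :
    Function.Injective (chartDeriv (n := n) p q) := by
  have : IsManifold (𝓡 n) 1 M := IsManifold.of_le (n := ∞) (by norm_cast)
  exact (isInvertible_mfderiv_extChartAt (I := 𝓡 n) hq).injective

end ChartDerivative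

/-! ### The metric and the Christoffel symbols in a chart. -/

section ChartForm

variable {n : ℕ} {M : Type*} [TopologicalSpace M] [ChartedSpace (EuclideanSpace ℝ (Fin n)) M]
  [Bundle.RiemannianBundle (fun p : M ↦ TangentSpace (𝓡 n) p)]

/-- The continuous bilinear form on `ℝⁿ` with the given matrix. -/
def matrixForm (g : Matrix (Fin n) (Fin n) ℝ) :
    EuclideanSpace ℝ (Fin n) →L[ℝ] EuclideanSpace ℝ (Fin n) →L[ℝ] ℝ :=
  ∑ i, ∑ j, g i j • (EuclideanSpace.proj (𝕜 := ℝ) i).smulRight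
    (EuclideanSpace.proj (𝕜 := ℝ) j)

lemma matrixForm_apply (g : Matrix (Fin n) (Fin n) ℝ) (u v : EuclideanSpace ℝ (Fin n)) :
    matrixForm g u v = ∑ i, ∑ j, g i j * u i * v j := by
  simp [matrixForm, sum_apply, mul_assoc]

/-- The Riemannian metric in the preferred chart at `p`, as a bilinear form. -/
def chartForm (p : M) (y : EuclideanSpace ℝ (Fin n)) :
    EuclideanSpace ℝ (Fin n) →L[ℝ] EuclideanSpace ℝ (Fin n) →L[ℝ] ℝ :=
  matrixForm (chartMetric p y)

lemma chartForm_eq_inner (p : M) (y u v : EuclideanSpace ℝ (Fin n)) :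
    chartForm p y u v = inner ℝ (chartSymmDeriv p y u) (chartSymmDeriv p y v) := by
  rw [chartForm, matrixForm_apply]
  exact sum_gram_mul (X := TangentSpace (𝓡 n) ((extChartAt (𝓡 n) p).symm y))
    (chartSymmDeriv p y).toLinearMap u v

lemma chartForm_symm (p : M) (y u v : EuclideanSpace ℝ (Fin n)) :
    chartForm p y u v = chartForm p y v u := by
  rw [chartForm_eq_inner, chartForm_eq_inner, real_inner_comm]

variable [IsManifold (𝓡 n) ∞ M]

lemma inner_eq_chartForm {p q : M} (hq : q ∈ (extChartAt (𝓡 n) p).source)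
    (v w : TangentSpace (𝓡 n) q) :
    inner ℝ v w = chartForm p (extChartAt (𝓡 n) p q) (chartDeriv p q v) (chartDeriv p q w) := by
  obtain ⟨y, hy, rfl⟩ : ∃ y ∈ (extChartAt (𝓡 n) p).target, q = (extChartAt (𝓡 n) p).symm y :=
    ⟨_, (extChartAt (𝓡 n) p).map_source hq, ((extChartAt (𝓡 n) p).left_inv hq).symm⟩
  rw [(extChartAt (𝓡 n) p).right_inv hy, chartForm_eq_inner,
    chartSymmDeriv_chartDeriv hy, chartSymmDeriv_chartDeriv hy]

lemma isUnit_det_chartMetric {p : M} {y : EuclideanSpace ℝ (Fin n)}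
    (hy : y ∈ (extChartAt (𝓡 n) p).target) : IsUnit (chartMetric p y).det := by
  refine isUnit_det_gram (X := TangentSpace (𝓡 n) ((extChartAt (𝓡 n) p).symm y))
    (chartSymmDeriv p y).toLinearMap ?_
  exact Function.LeftInverse.injective fun u ↦ chartDeriv_chartSymmDeriv hy u

/-- The coordinate fields are smooth, being the tangent map of the inverse chart applied to constant
fields, and the bundle metric is smooth. -/
lemma differentiableAt_chartMetric
    [IsContMDiffRiemannianBundle (𝓡 n) ∞ (EuclideanSpace ℝ (Fin n))
      (fun p : M ↦ TangentSpace (𝓡 n) p)] {p : M} {y : EuclideanSpace ℝ (Fin n)}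
    (hy : y ∈ (extChartAt (𝓡 n) p).target) (i j : Fin n) :
    DifferentiableAt ℝ (fun z ↦ chartMetric p z i j) y := by
  have hsec : ∀ a : EuclideanSpace ℝ (Fin n), ContMDiffAt (𝓡 n) (𝓡 n).tangent ∞
      (fun z ↦ (⟨(extChartAt (𝓡 n) p).symm z,
        mfderiv (𝓡 n) (𝓡 n) (extChartAt (𝓡 n) p).symm z a⟩ : TangentBundle (𝓡 n) M)) y := by
    intro a
    have hopen : IsOpen (extChartAt (𝓡 n) p).target := isOpen_extChartAt_target p
    have h1 := (contMDiffOn_extChartAt_symm (I := 𝓡 n) (n := ∞) p).contMDiffOn_tangentMapWithin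
      (m := ∞) (by simp) hopen.uniqueMDiffOn
    have h2 : ContMDiffAt (𝓡 n) (𝓡 n).tangent ∞
        (fun z : EuclideanSpace ℝ (Fin n) ↦
          (⟨z, a⟩ : TangentBundle (𝓡 n) (EuclideanSpace ℝ (Fin n)))) y := by
      exact contMDiffAt_vectorSpace_iff_contDiffAt.2 contDiffAt_const
    have hev : ∀ᶠ z in 𝓝 y, z ∈ (extChartAt (𝓡 n) p).target := hopen.mem_nhds hy
    have h3 := (h1.contMDiffAt ((hopen.preimage
      (FiberBundle.continuous_proj _ _)).mem_nhds hy)).comp y h2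
    refine h3.congr_of_eventuallyEq ?_
    filter_upwards [hev] with z hz
    simp only [Function.comp_apply, tangentMapWithin,
      mfderivWithin_of_isOpen hopen hz]
  have h := (ContMDiffAt.inner_bundle (hsec (EuclideanSpace.single i 1))
    (hsec (EuclideanSpace.single j 1)))
  exact (contMDiffAt_iff_contDiffAt.1 h).differentiableAt (by simp)

set_option synthInstance.maxHeartbeats 200000 in
lemma differentiableAt_chartForm
    [IsContMDiffRiemannianBundle (𝓡 n) ∞ (EuclideanSpace ℝ (Fin n))
      (fun p : M ↦ TangentSpace (𝓡 n) p)] {p : M} {y : EuclideanSpace ℝ (Fin n)}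
    (hy : y ∈ (extChartAt (𝓡 n) p).target) : DifferentiableAt ℝ (chartForm p) y := by
  exact differentiableAt_sum_smul
    (Y := EuclideanSpace ℝ (Fin n) →L[ℝ] EuclideanSpace ℝ (Fin n) →L[ℝ] ℝ)
    (g := chartMetric p) (differentiableAt_chartMetric hy)
    fun i j ↦ (EuclideanSpace.proj (𝕜 := ℝ) i).smulRight (EuclideanSpace.proj (𝕜 := ℝ) j)

set_option synthInstance.maxHeartbeats 200000 in
lemma fderiv_chartForm_apply
    [IsContMDiffRiemannianBundle (𝓡 n) ∞ (EuclideanSpace ℝ (Fin n))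
      (fun p : M ↦ TangentSpace (𝓡 n) p)] {p : M} {y : EuclideanSpace ℝ (Fin n)}
    (hy : y ∈ (extChartAt (𝓡 n) p).target) (a u v : EuclideanSpace ℝ (Fin n)) :
    fderiv ℝ (chartForm p) y a u v =
      ∑ i, ∑ j, ∑ k, chartMetricDeriv p y k i j * a k * u i * v j := by
  have h : ∀ i j, fderiv ℝ (fun z ↦ chartMetric p z i j) y a
      = ∑ k, chartMetricDeriv p y k i j * a k := by
    intro i j
    conv_lhs => rw [← euclidean_sum_smul_single a]
    simp [map_sum, chartMetricDeriv, mul_comm]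
  have h1 := ((differentiableAt_chartForm hy).hasFDerivAt.clm_apply
    (hasFDerivAt_const u y)).clm_apply (hasFDerivAt_const v y)
  have h2 : HasFDerivAt (fun z ↦ chartForm p z u v) (∑ i, ∑ j, (v j) • (u i) •
      fderiv ℝ (fun z ↦ chartMetric p z i j) y) y := by
    simp only [chartForm, matrixForm_apply]
    exact HasFDerivAt.fun_sum fun i _ ↦ HasFDerivAt.fun_sum fun j _ ↦
      ((differentiableAt_chartMetric hy i j).hasFDerivAt.mul_const _).mul_const _
  have h3 := DFunLike.congr_fun (h1.unique h2) a
  simp only [ContinuousLinearMap.comp_zero, zero_add, ContinuousLinearMap.flip_apply,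
    sum_apply, smul_apply, smul_eq_mul, h] at h3
  rw [h3]
  refine Finset.sum_congr rfl fun i _ ↦ Finset.sum_congr rfl fun j _ ↦ ?_
  rw [← mul_assoc, Finset.mul_sum]
  exact Finset.sum_congr rfl fun k _ ↦ by ring

-- Lowering the index cancels the inverse metric in the Christoffel symbols. On the diagonal `(u,
-- u)` this leaves the Koszul expression of `christoffel_transformation`.
set_option synthInstance.maxHeartbeats 200000 in
lemma chartForm_christoffel [IsContMDiffRiemannianBundle (𝓡 n) ∞ (EuclideanSpace ℝ (Fin n))
      (fun p : M ↦ TangentSpace (𝓡 n) p)] {p : M} {y : EuclideanSpace ℝ (Fin n)}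
    (hy : y ∈ (extChartAt (𝓡 n) p).target) (w u : EuclideanSpace ℝ (Fin n)) :
    2 * chartForm p y w (christoffel p y u u)
      = 2 * fderiv ℝ (chartForm p) y u u w - fderiv ℝ (chartForm p) y w u u := by
  have hlow : ∀ l i j, ∑ k, chartMetric p y l k * christoffelSymbol p y k i j = 1 / 2 *
      (chartMetricDeriv p y i j l + chartMetricDeriv p y j i l - chartMetricDeriv p y l i j) := by
    intro l i j
    set D : Fin n → ℝ := fun l ↦
      chartMetricDeriv p y i j l + chartMetricDeriv p y j i l - chartMetricDeriv p y l i j with hD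
    have h1 : (chartMetric p y).mulVec ((chartMetric p y)⁻¹.mulVec D) = D := by
      rw [Matrix.mulVec_mulVec, Matrix.mul_nonsing_inv _ (isUnit_det_chartMetric hy),
        Matrix.one_mulVec]
    have h2 := congrFun h1 l
    simp only [Matrix.mulVec, dotProduct] at h2
    refine Eq.trans ?_ (congrArg (1 / 2 * ·) h2)
    simp only [Finset.mul_sum]
    refine Finset.sum_congr rfl fun k _ ↦ ?_
    simp only [christoffelSymbol, hD, Finset.mul_sum]
    exact Finset.sum_congr rfl fun i _ ↦ by ring
  have h3 : chartForm p y w (christoffel p y u u) = ∑ l, ∑ i, ∑ j,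
      (∑ k, chartMetric p y l k * christoffelSymbol p y k i j) * w l * u i * u j := by
    rw [chartForm, matrixForm_apply]
    refine Finset.sum_congr rfl fun l _ ↦ ?_
    simp only [christoffel, Finset.mul_sum, Finset.sum_mul]
    rw [Finset.sum_comm]
    refine Finset.sum_congr rfl fun i _ ↦ ?_
    rw [Finset.sum_comm]
    refine Finset.sum_congr rfl fun j _ ↦ Finset.sum_congr rfl fun k _ ↦ ?_
    ring
  have h4 : ∀ a b c : EuclideanSpace ℝ (Fin n), fderiv ℝ (chartForm p) y a b c =
      ∑ l, ∑ i, ∑ j, chartMetricDeriv p y i j l * a i * b j * c l := by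
    intro a b c
    rw [fderiv_chartForm_apply hy, Finset.sum_comm]
    refine Finset.sum_congr rfl fun l _ ↦ ?_
    rw [Finset.sum_comm]
  have h5 : fderiv ℝ (chartForm p) y u u w =
      ∑ l, ∑ i, ∑ j, chartMetricDeriv p y j i l * u i * u j * w l := by
    rw [h4]
    refine Finset.sum_congr rfl fun l _ ↦ ?_
    rw [Finset.sum_comm]
    refine Finset.sum_congr rfl fun i _ ↦ Finset.sum_congr rfl fun j _ ↦ ?_
    ring
  have h6 : fderiv ℝ (chartForm p) y w u u =
      ∑ l, ∑ i, ∑ j, chartMetricDeriv p y l i j * u i * u j * w l := by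
    rw [fderiv_chartForm_apply hy]
    rw [Finset.sum_congr rfl fun i _ ↦ Finset.sum_comm, Finset.sum_comm]
    refine Finset.sum_congr rfl fun l _ ↦ Finset.sum_congr rfl fun i _ ↦
      Finset.sum_congr rfl fun j _ ↦ ?_
    ring
  -- The two equal summands are expanded with `i` and `j` in opposite roles, to match the terms `∂ᵢ
  -- gⱼₗ` and `∂ⱼ gᵢₗ`.
  rw [two_mul (fderiv ℝ (chartForm p) y u u w)]
  nth_rewrite 1 [h4]
  rw [h5, h6, h3]
  simp only [hlow, ← Finset.sum_add_distrib, ← Finset.sum_sub_distrib, Finset.mul_sum]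
  refine Finset.sum_congr rfl fun l _ ↦ Finset.sum_congr rfl fun i _ ↦
    Finset.sum_congr rfl fun j _ ↦ ?_
  ring

end ChartForm

/-! ### The trace with respect to an induced metric. -/

section Gram

variable {k : ℕ} {X : Type*} [NormedAddCommGroup X] [InnerProductSpace ℝ X]

/-- If `A` preserves the metric induced by `L` and reverses the sign of the quadratic form of `β`,
then the trace of `β` with respect to this metric vanishes. -/
lemma gram_trace_eq_zero (L : EuclideanSpace ℝ (Fin k) →ₗ[ℝ] X) (hL : Function.Injective L)
    (β : EuclideanSpace ℝ (Fin k) →ₗ[ℝ] EuclideanSpace ℝ (Fin k) →ₗ[ℝ] ℝ)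
    (A : EuclideanSpace ℝ (Fin k) →ₗ[ℝ] EuclideanSpace ℝ (Fin k))
    (hA : ∀ u v, inner ℝ (L (A u)) (L (A v)) = inner ℝ (L u) (L v))
    (hβ : ∀ h, β (A h) (A h) = -β h h) :
    ∑ i, ∑ j, (Matrix.of fun i j : Fin k ↦ inner ℝ (L (EuclideanSpace.single i (1 : ℝ)))
      (L (EuclideanSpace.single j (1 : ℝ))))⁻¹ i j
      * β (EuclideanSpace.single i 1) (EuclideanSpace.single j 1) = 0 := by
  have hq : ∀ v : Fin k → ℝ, v ⬝ᵥ (Matrix.of fun i j : Fin k ↦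
      β (EuclideanSpace.single i 1) (EuclideanSpace.single j 1)).mulVec v
      = β (WithLp.toLp 2 v) (WithLp.toLp 2 v) := by
    intro v
    conv_rhs => rw [← euclidean_sum_smul_single (WithLp.toLp 2 v)]
    simp [map_sum, LinearMap.sum_apply, Matrix.mulVec, dotProduct, Finset.mul_sum]
    rw [Finset.sum_comm]
    refine Finset.sum_congr rfl fun i _ ↦ Finset.sum_congr rfl fun j _ ↦ ?_
    ring
  have hm : ∀ v : Fin k → ℝ, WithLp.toLp 2 ((Matrix.of fun i j : Fin k ↦
      A (EuclideanSpace.single j 1) i).mulVec v) = A (WithLp.toLp 2 v) := by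
    intro v
    conv_rhs => rw [← euclidean_sum_smul_single (WithLp.toLp 2 v)]
    ext i
    simp [map_sum, Matrix.mulVec, dotProduct, mul_comm]
  refine trace_eq_zero_of_isometry_neg (Q := Matrix.of fun i j : Fin k ↦
      β (EuclideanSpace.single i 1) (EuclideanSpace.single j 1))
      (A := Matrix.of fun i j : Fin k ↦ A (EuclideanSpace.single j 1) i)
      (isUnit_det_gram L hL) ?_ ?_ ?_
  · ext i j
    simp [real_inner_comm]
  · ext i j
    rw [Matrix.of_apply, ← hA, ← sum_gram_mul L, Matrix.mul_assoc, Matrix.mul_apply]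
    refine Finset.sum_congr rfl fun a _ ↦ ?_
    rw [Matrix.mul_apply, Finset.mul_sum]
    refine Finset.sum_congr rfl fun b _ ↦ ?_
    simp only [Matrix.transpose_apply, Matrix.of_apply]
    ring
  · intro v
    rw [hq, hq, hm, hβ]

end Gram

/-! ### Sign reversal of the normal Hessian. -/

section SignReversal

variable {V W : Type*} [NormedAddCommGroup V] [NormedSpace ℝ V]
  [NormedAddCommGroup W] [NormedSpace ℝ W]

set_option synthInstance.maxHeartbeats 200000 in
/-- The normal component of the covariant Hessian of `F` in the direction `w` changes sign under the
transition map `θ`, if `Φ` is an isometry near `F x`, maps the image of `F` to itself and satisfies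
`dΦ w = -w`. Here `Γ` is the quadratic form given by the Christoffel symbols. -/
lemma normal_hessian_neg {G : W → W →L[ℝ] W →L[ℝ] ℝ} {G' : W →L[ℝ] W →L[ℝ] W →L[ℝ] ℝ}
    {Φ : W → W} {Φ' : W → W →L[ℝ] W} {Φ'' : W →L[ℝ] W →L[ℝ] W} {x : V}
    {F : V → W} {F' : V → V →L[ℝ] W} {F'' : V →L[ℝ] V →L[ℝ] W} {θ : V → V} {A : V →L[ℝ] V}
    {Γ : W → W} {w : W}
    (hG : HasFDerivAt G G' (F x)) (hGsymm : ∀ z u v, G z u v = G z v u)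
    (hΦ : ∀ᶠ z in 𝓝 (F x), HasFDerivAt Φ (Φ' z) z) (hΦ' : HasFDerivAt Φ' Φ'' (F x))
    (hy : Φ (F x) = F x)
    (hiso : ∀ᶠ z in 𝓝 (F x), ∀ u v, G (Φ z) (Φ' z u) (Φ' z v) = G z u v)
    (hF : ∀ᶠ z in 𝓝 x, HasFDerivAt F (F' z) z) (hF' : HasFDerivAt F' F'' x)
    (hθ : HasFDerivAt θ A x) (hθx : θ x = x) (hFθ : ∀ᶠ z in 𝓝 x, F (θ z) = Φ (F z))
    (hA : ∀ h, F' x (A h) = Φ' (F x) (F' x h))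
    (hΓ : ∀ u b, 2 * G (F x) b (Γ u) = 2 * G' u u b - G' b u u)
    (hw : Φ' (F x) w = -w) (hwF : ∀ a, G (F x) w (F' x a) = 0) (h : V) :
    G (F x) w (F'' (A h) (A h) + Γ (F' x (A h))) = -G (F x) w (F'' h h + Γ (F' x h)) := by
  set ν : W →L[ℝ] ℝ := G (F x) w with hν
  have hFx := hF.self_of_nhds
  -- `Φ' (F x)` is an isometry that sends `w` to `-w`.
  have hνΦ : ∀ b, ν (Φ' (F x) b) = -ν b := by
    intro b
    have := hiso.self_of_nhds w b
    rw [hw, hy, map_neg, neg_apply] at this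
    linarith
  have hr : ∀ᶠ z in 𝓝 x, HasFDerivAt (fun z ↦ ν (F z)) (ν.comp (F' z)) z := by
    filter_upwards [hF] with z hz using ν.hasFDerivAt.comp z hz
  have hr' : HasFDerivAt (fun z ↦ ν.comp (F' z)) ((ContinuousLinearMap.compL ℝ V W ℝ ν).comp F'') x :=
    (ContinuousLinearMap.compL ℝ V W ℝ ν).hasFDerivAt.comp x hF'
  have hr0 : ν.comp (F' x) = 0 := by ext a; exact hwF a
  have hs : ∀ᶠ z in 𝓝 x, HasFDerivAt (fun z ↦ ν (Φ (F z)))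
      (ν.comp ((Φ' (F z)).comp (F' z))) z := by
    filter_upwards [hF, hFx.continuousAt.eventually hΦ] with z hz hz'
    exact ν.hasFDerivAt.comp z (hz'.comp z hz)
  have hs' := (ContinuousLinearMap.compL ℝ V W ℝ ν).hasFDerivAt.comp x
    ((hΦ'.comp x hFx).clm_comp hF')
  have hs0 : ν.comp ((Φ' (F x)).comp (F' x)) = 0 := by
    ext a
    simp [hνΦ, hwF]
  -- Normality of `w` makes `x` critical for both `ν ∘ F` and `ν ∘ Φ ∘ F`.
  have key := second_derivative_comp_of_critical hr hr' hr0 hs hs' hs0 hθ hθx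
    (hFθ.mono fun z hz ↦ by rw [hz]) h
  simp only [ContinuousLinearMap.comp_apply, Function.comp_apply, add_apply, map_add,
    ContinuousLinearMap.compL_apply, ContinuousLinearMap.flip_apply, hνΦ] at key
  -- The `Φ''` term left in `key` is exactly the inhomogeneous term of the transformation law, so it
  -- is traded for the two values of `Γ`.
  have hc := christoffel_transformation hG hGsymm hΦ hΦ' hy hiso (F' x h) w
  rw [← hA, hw, ← hΓ] at hc
  have hΓ' := hΓ (F' x h) w
  simp only [map_neg, neg_apply, ← hν] at hc hΓ'
  rw [map_add, map_add]
  linarith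

end SignReversal

/-! ### The map induced on parameters. -/

section Transition

variable {n m : ℕ} {M : Type*} [TopologicalSpace M] [ChartedSpace (EuclideanSpace ℝ (Fin n)) M]

/-- A continuous map of `S` to itself that fixes a regular point is, in a local parametrization, a
map of the parameters that is continuous at the corresponding parameter. -/
lemma LocalParametrization.exists_transition {S : Set M}
    (P : LocalParametrization (n := n) S m) {x : EuclideanSpace ℝ (Fin m)} (hx : x ∈ P.domain)
    {φ : M → M} (hφ : Continuous φ) (hφS : Set.MapsTo φ S S) (hφx : φ (P.toFun x) = P.toFun x) :
    ∃ θ : EuclideanSpace ℝ (Fin m) → EuclideanSpace ℝ (Fin m), ContinuousAt θ x ∧ θ x = x ∧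
      ∀ᶠ z in 𝓝 x, P.toFun (θ z) = φ (P.toFun z) := by
  obtain ⟨O, hO, hPO⟩ := P.image_eq
  have hcont : ContinuousAt P.toFun x :=
    (P.mdifferentiableOn.continuousOn).continuousAt (P.isOpen_domain.mem_nhds hx)
  have hmem : ∀ z ∈ P.domain, P.toFun z ∈ S ∩ O := fun z hz ↦ hPO ▸ Set.mem_image_of_mem _ hz
  have hφc : ContinuousAt (fun z ↦ φ (P.toFun z)) x := hφ.continuousAt.comp hcont
  -- The image of `P` is relatively open in `S`, so `φ (P.toFun z)` stays in it for `z` near `x`.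
  have hex : ∀ᶠ z in 𝓝 x, ∃ z' ∈ P.domain, P.toFun z' = φ (P.toFun z) := by
    have h1 : ∀ᶠ z in 𝓝 x, φ (P.toFun z) ∈ O :=
      hφc.eventually (hO.mem_nhds (by simpa only [hφx] using (hmem x hx).2))
    filter_upwards [h1, P.isOpen_domain.mem_nhds hx] with z hz hzd
    have h2 : φ (P.toFun z) ∈ S ∩ O := ⟨hφS (hmem z hzd).1, hz⟩
    rw [← hPO] at h2
    exact h2
  classical
  -- Values in the subtype allow continuity to be tested through the embedding; the default `x` is
  -- not taken near `x` except where `hex` forces it.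
  let θ : EuclideanSpace ℝ (Fin m) → P.domain := fun z ↦
    if h : ∃ z' ∈ P.domain, P.toFun z' = φ (P.toFun z) then ⟨h.choose, h.choose_spec.1⟩
    else ⟨x, hx⟩
  have hθ : ∀ᶠ z in 𝓝 x, P.toFun (θ z) = φ (P.toFun z) := by
    filter_upwards [hex] with z hz
    simp only [θ, dif_pos hz]
    exact hz.choose_spec.2
  have hθx : θ x = ⟨x, hx⟩ := by
    apply P.isEmbedding.injective
    exact hθ.self_of_nhds.trans hφx
  refine ⟨fun z ↦ θ z, ?_, congrArg Subtype.val hθx, hθ⟩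
  refine continuous_subtype_val.continuousAt.comp (f := θ) ?_
  rw [P.isEmbedding.isInducing.continuousAt_iff]
  exact hφc.congr (by filter_upwards [hθ] with z hz using hz.symm)

end Transition

variable {n m : ℕ} {M : Type*} [TopologicalSpace M] [ChartedSpace (EuclideanSpace ℝ (Fin n)) M]

/-! ### Normality of the mean curvature vector. -/

section Normal

variable [Bundle.RiemannianBundle (fun p : M ↦ TangentSpace (𝓡 n) p)]

lemma meanCurvatureVector_mem_orthogonal (f : EuclideanSpace ℝ (Fin m) → M)
    (x : EuclideanSpace ℝ (Fin m)) :
    meanCurvatureVector (n := n) f x ∈ (tangentSubspace (n := n) f x)ᗮ :=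
  Submodule.sum_mem _ fun _ _ ↦ Submodule.sum_mem _ fun _ _ ↦ Submodule.smul_mem _ _
    (Submodule.starProjection_apply_mem _ _)

end Normal

variable [IsManifold (𝓡 n) ∞ M]

/-! ### Maps into `M` and self-maps of `M` in coordinates. -/

section Coordinates

variable {p : M}

/-- The expression of a self-map of `M` in the preferred chart at `p`. -/
def chartMap (p : M) (φ : M → M) (y : EuclideanSpace ℝ (Fin n)) : EuclideanSpace ℝ (Fin n) :=
  extChartAt (𝓡 n) p (φ ((extChartAt (𝓡 n) p).symm y))

lemma contDiffAt_chartMap {φ : M → M} (hφ : ContMDiff (𝓡 n) (𝓡 n) ∞ φ) (hp : φ p = p) :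
    ContDiffAt ℝ ∞ (chartMap (n := n) p φ) (extChartAt (𝓡 n) p p) := by
  have h1 : ContMDiffAt (𝓡 n) (𝓡 n) ∞ (extChartAt (𝓡 n) p).symm (extChartAt (𝓡 n) p p) :=
    (contMDiffOn_extChartAt_symm p).contMDiffAt (extChartAt_target_mem_nhds p)
  have h3 : ContMDiffAt (𝓡 n) (𝓡 n) ∞ (extChartAt (𝓡 n) p)
      (φ ((extChartAt (𝓡 n) p).symm (extChartAt (𝓡 n) p p))) := by
    rw [extChartAt_to_inv, hp]
    exact contMDiffAt_extChartAt
  exact contMDiffAt_iff_contDiffAt.1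
    (h3.comp (extChartAt (𝓡 n) p p) (hφ.contMDiffAt.comp (extChartAt (𝓡 n) p p) h1))

lemma hasFDerivAt_chartMap {φ : M → M} (hφ : ContMDiff (𝓡 n) (𝓡 n) ∞ φ)
    {y : EuclideanSpace ℝ (Fin n)} (hy : y ∈ (extChartAt (𝓡 n) p).target)
    (hφy : φ ((extChartAt (𝓡 n) p).symm y) ∈ (extChartAt (𝓡 n) p).source) :
    HasFDerivAt (chartMap p φ) ((chartDeriv p (φ ((extChartAt (𝓡 n) p).symm y))).comp
      ((mfderiv (𝓡 n) (𝓡 n) φ ((extChartAt (𝓡 n) p).symm y)).comp (chartSymmDeriv p y))) y := by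
  have h1 := (mdifferentiableAt_extChartAt_symm_of_mem_target hy).hasMFDerivAt
  have h2 := (hφ.mdifferentiable (by simp) ((extChartAt (𝓡 n) p).symm y)).hasMFDerivAt
  have h3 := (mdifferentiableAt_extChartAt_of_mem_source hφy).hasMFDerivAt
  exact hasMFDerivAt_iff_hasFDerivAt.1 (h3.comp y (h2.comp y h1))

lemma fderiv_chartMap_chartDeriv {φ : M → M} (hφ : ContMDiff (𝓡 n) (𝓡 n) ∞ φ) {q : M}
    (hq : q ∈ (extChartAt (𝓡 n) p).source) (hφq : φ q ∈ (extChartAt (𝓡 n) p).source)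
    (v : TangentSpace (𝓡 n) q) :
    fderiv ℝ (chartMap p φ) (extChartAt (𝓡 n) p q) (chartDeriv p q v) =
      chartDeriv p (φ q) (mfderiv (𝓡 n) (𝓡 n) φ q v) := by
  obtain ⟨y, hy, rfl⟩ : ∃ y ∈ (extChartAt (𝓡 n) p).target, q = (extChartAt (𝓡 n) p).symm y :=
    ⟨_, (extChartAt (𝓡 n) p).map_source hq, ((extChartAt (𝓡 n) p).left_inv hq).symm⟩
  rw [(extChartAt (𝓡 n) p).right_inv hy, (hasFDerivAt_chartMap hφ hy hφq).fderiv,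
    ContinuousLinearMap.comp_apply, ContinuousLinearMap.comp_apply, chartSymmDeriv_chartDeriv hy]

/-- The differential at `z` of a map `f : ℝᵐ → M`. -/
def paramDeriv (f : EuclideanSpace ℝ (Fin m) → M) (z : EuclideanSpace ℝ (Fin m)) :
    EuclideanSpace ℝ (Fin m) →L[ℝ] TangentSpace (𝓡 n) (f z) :=
  mfderiv (𝓡 m) (𝓡 n) f z

lemma hasFDerivAt_extChartAt_comp {f : EuclideanSpace ℝ (Fin m) → M}
    {z : EuclideanSpace ℝ (Fin m)} (hf : MDifferentiableAt (𝓡 m) (𝓡 n) f z)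
    (hz : f z ∈ (extChartAt (𝓡 n) p).source) :
    HasFDerivAt (extChartAt (𝓡 n) p ∘ f)
      ((chartDeriv p (f z)).comp (paramDeriv f z)) z := by
  have h3 := (mdifferentiableAt_extChartAt_of_mem_source hz).hasMFDerivAt
  exact hasMFDerivAt_iff_hasFDerivAt.1 (h3.comp z hf.hasMFDerivAt)

end Coordinates

variable [Bundle.RiemannianBundle (fun p : M ↦ TangentSpace (𝓡 n) p)]

/-! ### Bilinearity of the Christoffel symbols. -/

section Christoffel

variable (p : M) (y : EuclideanSpace ℝ (Fin n))

/-- The Christoffel symbols as a bilinear map. -/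
def christoffelBilin : EuclideanSpace ℝ (Fin n) →ₗ[ℝ] EuclideanSpace ℝ (Fin n) →ₗ[ℝ]
    EuclideanSpace ℝ (Fin n) :=
  LinearMap.mk₂ ℝ (christoffel p y)
    (fun u u' v ↦ by ext k; simp [christoffel, mul_add, add_mul, Finset.sum_add_distrib])
    (fun c u v ↦ by
      ext k
      simp only [christoffel, PiLp.smul_apply, smul_eq_mul, Finset.mul_sum]
      exact Finset.sum_congr rfl fun i _ ↦ Finset.sum_congr rfl fun j _ ↦ by ring)
    (fun u v v' ↦ by ext k; simp [christoffel, mul_add, Finset.sum_add_distrib])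
    (fun c u v ↦ by
      ext k
      simp only [christoffel, PiLp.smul_apply, smul_eq_mul, Finset.mul_sum]
      exact Finset.sum_congr rfl fun i _ ↦ Finset.sum_congr rfl fun j _ ↦ by ring)

end Christoffel

/-! ### Isometries and the second fundamental form in coordinates; the conclusion. -/

lemma IsRiemannianIsometry.chartForm_eq {φ : M ≃ₘ⟮𝓡 n, 𝓡 n⟯ M} (hφ : IsRiemannianIsometry φ)
    {p : M} {y : EuclideanSpace ℝ (Fin n)} (hy : y ∈ (extChartAt (𝓡 n) p).target)
    (hφy : φ ((extChartAt (𝓡 n) p).symm y) ∈ (extChartAt (𝓡 n) p).source)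
    (u v : EuclideanSpace ℝ (Fin n)) :
    chartForm p (chartMap p φ y) (fderiv ℝ (chartMap p φ) y u) (fderiv ℝ (chartMap p φ) y v)
      = chartForm p y u v := by
  rw [(hasFDerivAt_chartMap φ.contMDiff hy hφy).fderiv, chartForm_eq_inner p y, ← hφ,
    inner_eq_chartForm hφy]
  rfl

/-- The second fundamental form takes values in the normal space, and its component in a normal
direction is computed by the covariant Hessian in the preferred chart. -/
lemma inner_secondFundamentalForm {f : EuclideanSpace ℝ (Fin m) → M}
    {x : EuclideanSpace ℝ (Fin m)} (hf : ∀ᶠ z in 𝓝 x, MDifferentiableAt (𝓡 m) (𝓡 n) f z)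
    (hf' : DifferentiableAt ℝ (fderiv ℝ (extChartAt (𝓡 n) (f x) ∘ f)) x)
    {w : TangentSpace (𝓡 n) (f x)} (hw : w ∈ (tangentSubspace (n := n) f x)ᗮ)
    (a b : EuclideanSpace ℝ (Fin m)) :
    inner ℝ w (secondFundamentalForm (n := n) f x a b) =
      chartForm (f x) (extChartAt (𝓡 n) (f x) (f x)) (chartDeriv (f x) (f x) w)
        (fderiv ℝ (fderiv ℝ (extChartAt (𝓡 n) (f x) ∘ f)) x a b +
          christoffel (f x) (extChartAt (𝓡 n) (f x) (f x))
            (fderiv ℝ (extChartAt (𝓡 n) (f x) ∘ f) x a)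
            (fderiv ℝ (extChartAt (𝓡 n) (f x) ∘ f) x b)) := by
  have hsrc : f x ∈ (extChartAt (𝓡 n) (f x)).source := mem_extChartAt_source (f x)
  have hev : ∀ᶠ z in 𝓝 x, f z ∈ (extChartAt (𝓡 n) (f x)).source :=
    hf.self_of_nhds.continuousAt.eventually (extChartAt_source_mem_nhds (f x))
  have hY : (fun z ↦ chartDeriv (f x) (f z) (paramDeriv f z b)) =ᶠ[𝓝 x]
      fun z ↦ fderiv ℝ (extChartAt (𝓡 n) (f x) ∘ f) z b := by
    filter_upwards [hf, hev] with z hz hz'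
    rw [(hasFDerivAt_extChartAt_comp hz hz').fderiv]
    rfl
  have hYd : fderiv ℝ (fun z ↦ chartDeriv (f x) (f z) (paramDeriv f z b)) x a =
      fderiv ℝ (fderiv ℝ (extChartAt (𝓡 n) (f x) ∘ f)) x a b := by
    rw [hY.fderiv_eq, fderiv_apply_const hf']
  have hcov : covariantDerivAlong (n := n) f (fun z ↦ mfderiv (𝓡 m) (𝓡 n) f z b) x a =
      (chartDeriv (f x) (f x)).inverse
        (fderiv ℝ (fderiv ℝ (extChartAt (𝓡 n) (f x) ∘ f)) x a b +
          christoffel (f x) (extChartAt (𝓡 n) (f x) (f x))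
            (fderiv ℝ (extChartAt (𝓡 n) (f x) ∘ f) x a)
            (fderiv ℝ (extChartAt (𝓡 n) (f x) ∘ f) x b)) := by
    have hYx : chartDeriv (f x) (f x) (paramDeriv f x b) =
        fderiv ℝ (extChartAt (𝓡 n) (f x) ∘ f) x b := hY.self_of_nhds
    rw [← hYd, ← hYx]
    rfl
  -- The normal projection is self-adjoint and fixes `w`, so it disappears.
  rw [secondFundamentalForm, ← Submodule.inner_starProjection_left_eq_right,
    Submodule.starProjection_eq_self_iff.2 hw, inner_eq_chartForm hsrc, hcov,
    chartDeriv_inverse_apply hsrc]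

set_option synthInstance.maxHeartbeats 200000 in
lemma meanCurvatureVector_eq_zero_of_isometry
    [IsContMDiffRiemannianBundle (𝓡 n) ∞ (EuclideanSpace ℝ (Fin n))
      (fun p : M ↦ TangentSpace (𝓡 n) p)]
    {S : Set M} (P : LocalParametrization (n := n) S m) {x : EuclideanSpace ℝ (Fin m)}
    (hx : x ∈ P.domain) {φ : M ≃ₘ⟮𝓡 n, 𝓡 n⟯ M} (hφ : IsRiemannianIsometry φ)
    (hφx : φ (P.toFun x) = P.toFun x) (hφS : φ '' S = S)
    (hneg : ∀ v ∈ (tangentSubspace (n := n) P.toFun x)ᗮ,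
        tangentMap (𝓡 n) (𝓡 n) φ ⟨P.toFun x, v⟩ = ⟨P.toFun x, -v⟩) :
    meanCurvatureVector (n := n) P.toFun x = 0 := by
  set f := P.toFun with hfdef
  set ψ := extChartAt (𝓡 n) (f x) with hψ
  set F := ψ ∘ f with hF
  set Φ := chartMap (n := n) (f x) φ with hΦdef
  have hsrc : f x ∈ ψ.source := mem_extChartAt_source (f x)
  have htgt : F x ∈ ψ.target := ψ.map_source hsrc
  have hleft : ψ.symm (F x) = f x := ψ.left_inv hsrc
  have hf : ∀ᶠ z in 𝓝 x, MDifferentiableAt (𝓡 m) (𝓡 n) f z := by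
    filter_upwards [P.isOpen_domain.eventually_mem hx] with z hz
    exact P.mdifferentiableOn.mdifferentiableAt (P.isOpen_domain.mem_nhds hz)
  have hfsrc : ∀ᶠ z in 𝓝 x, f z ∈ ψ.source :=
    hf.self_of_nhds.continuousAt.eventually (extChartAt_source_mem_nhds (f x))
  have hFd : ∀ᶠ z in 𝓝 x, HasFDerivAt F (fderiv ℝ F z) z := by
    filter_upwards [hf, hfsrc] with z hz hz'
    exact (hasFDerivAt_extChartAt_comp hz hz').differentiableAt.hasFDerivAt
  have hFx : fderiv ℝ F x = (chartDeriv (f x) (f x)).comp (paramDeriv f x) :=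
    (hasFDerivAt_extChartAt_comp hf.self_of_nhds hsrc).fderiv
  have hF'd : HasFDerivAt (fderiv ℝ F) (fderiv ℝ (fderiv ℝ F) x) x :=
    (P.differentiableAt_fderiv x hx).hasFDerivAt
  have hgood : ∀ᶠ y in 𝓝 (F x), y ∈ ψ.target ∧ φ (ψ.symm y) ∈ ψ.source := by
    refine Filter.Eventually.and (extChartAt_target_mem_nhds (I := 𝓡 n) (f x)) ?_
    have hc : ContinuousAt (fun y ↦ φ (ψ.symm y)) (F x) :=
      φ.continuous.continuousAt.comp (continuousAt_extChartAt_symm (f x))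
    refine hc.eventually (?_ : ∀ᶠ q in 𝓝 (φ (ψ.symm (F x))), q ∈ ψ.source)
    rw [hleft, hφx]
    exact extChartAt_source_mem_nhds (f x)
  have hΦd : ∀ᶠ y in 𝓝 (F x), HasFDerivAt Φ (fderiv ℝ Φ y) y := by
    filter_upwards [hgood] with y hy
    exact (hasFDerivAt_chartMap φ.contMDiff hy.1 hy.2).differentiableAt.hasFDerivAt
  have hΦ'd : HasFDerivAt (fderiv ℝ Φ) (fderiv ℝ (fderiv ℝ Φ) (F x)) (F x) :=
    (((contDiffAt_chartMap φ.contMDiff hφx).fderiv_right (m := 1) (by norm_cast)).differentiableAt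
      (by simp)).hasFDerivAt
  have hΦfix : Φ (F x) = F x := by
    simp only [hΦdef, chartMap]
    rw [hleft, hφx]
    rfl
  have hiso : ∀ᶠ y in 𝓝 (F x), ∀ u v,
      chartForm (f x) (Φ y) (fderiv ℝ Φ y u) (fderiv ℝ Φ y v) = chartForm (f x) y u v := by
    filter_upwards [hgood] with y hy u v using hφ.chartForm_eq hy.1 hy.2 u v
  obtain ⟨θ, hθc, hθx, hθ⟩ := P.exists_transition hx φ.continuous
    (fun q hq ↦ hφS ▸ Set.mem_image_of_mem _ hq) hφx
  have hFθ : ∀ᶠ z in 𝓝 x, F (θ z) = Φ (F z) := by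
    filter_upwards [hθ, hfsrc] with z hz hz'
    simp only [hF, hΦdef, chartMap, Function.comp_apply, ← hψ, ψ.left_inv hz']
    exact congrArg ψ hz
  have hFinj : Function.Injective (fderiv ℝ F x) := by
    rw [hFx]
    exact (chartDeriv_injective hsrc).comp (P.injective_mfderiv x hx)
  -- A left inverse of the differential of `F` recovers the derivative of `θ` from that of `F ∘ θ =
  -- Φ ∘ F`.
  obtain ⟨L, hL⟩ : ∃ L : EuclideanSpace ℝ (Fin n) →L[ℝ] EuclideanSpace ℝ (Fin m),
      ∀ v, L (fderiv ℝ F x v) = v := by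
    obtain ⟨L, hL⟩ := (fderiv ℝ F x).toLinearMap.exists_leftInverse_of_injective
      (LinearMap.ker_eq_bot.2 hFinj)
    exact ⟨L.toContinuousLinearMap, fun v ↦ DFunLike.congr_fun hL v⟩
  have hΦF : HasFDerivAt (fun z ↦ F (θ z)) ((fderiv ℝ Φ (F x)).comp (fderiv ℝ F x)) x :=
    (hΦd.self_of_nhds.comp x hFd.self_of_nhds).congr_of_eventuallyEq hFθ
  have hθd := hasFDerivAt_of_comp_immersion hFd.self_of_nhds hL hΦF hθc hθx
  set A := L.comp ((fderiv ℝ Φ (F x)).comp (fderiv ℝ F x)) with hAdef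
  have hA : ∀ h, fderiv ℝ F x (A h) = fderiv ℝ Φ (F x) (fderiv ℝ F x h) := by
    intro h
    have h1 : HasFDerivAt F (fderiv ℝ F x) (θ x) := by rw [hθx]; exact hFd.self_of_nhds
    exact DFunLike.congr_fun ((h1.comp x hθd).unique hΦF) h
  have hΓ := fun u b ↦ chartForm_christoffel htgt b u
  have hinner : ∀ u v : TangentSpace (𝓡 n) (f x), inner ℝ u v =
      chartForm (f x) (F x) (chartDeriv (f x) (f x) u) (chartDeriv (f x) (f x) v) :=
    inner_eq_chartForm hsrc
  -- The normal direction tested is the mean curvature vector itself.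
  set w := meanCurvatureVector (n := n) f x with hw
  have hwN := meanCurvatureVector_mem_orthogonal (n := n) f x
  rw [← hw] at hwN
  have hΦw : fderiv ℝ Φ (F x) (chartDeriv (f x) (f x) w) = -chartDeriv (f x) (f x) w := by
    have h1 := fderiv_chartMap_chartDeriv (p := f x) φ.contMDiff hsrc (by rwa [hφx]) w
    -- `hneg` equates points of the tangent bundle, as the fibres over `φ (f x)` and `f x` are
    -- different types; the chart differential brings both sides into `ℝⁿ`.
    have h2 := congrArg (fun t : TangentBundle (𝓡 n) M ↦ chartDeriv (f x) t.proj t.snd)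
      (hneg w hwN)
    rw [← map_neg]
    exact h1.trans h2
  have hwF : ∀ a, chartForm (f x) (F x) (chartDeriv (f x) (f x) w) (fderiv ℝ F x a) = 0 := by
    intro a
    rw [hFx]
    refine (hinner _ _).symm.trans ?_
    exact Submodule.inner_left_of_mem_orthogonal (LinearMap.mem_range_self _ a) hwN
  have hsign := fun h ↦ normal_hessian_neg (differentiableAt_chartForm htgt).hasFDerivAt
    (chartForm_symm (f x)) hΦd hΦ'd hΦfix hiso hFd hF'd hθd hθx hFθ hA
    (Γ := fun u ↦ christoffel (f x) (F x) u u) hΓ hΦw hwF h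
  -- The `w`-component of the second fundamental form, pulled back to parameters; `hsign` says that
  -- `A` reverses its quadratic form.
  let β : EuclideanSpace ℝ (Fin m) →ₗ[ℝ] EuclideanSpace ℝ (Fin m) →ₗ[ℝ] ℝ :=
    LinearMap.compr₂ (ContinuousLinearMap.toLinearMap₁₂ (fderiv ℝ (fderiv ℝ F) x) +
      (christoffelBilin (f x) (F x)).compl₁₂ (fderiv ℝ F x).toLinearMap (fderiv ℝ F x).toLinearMap)
      (chartForm (f x) (F x) (chartDeriv (f x) (f x) w)).toLinearMap
  have htrace := gram_trace_eq_zero (X := TangentSpace (𝓡 n) (f x))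
    (paramDeriv f x).toLinearMap (P.injective_mfderiv x hx) β A.toLinearMap (by
      intro u v
      have h1 := hiso.self_of_nhds (fderiv ℝ F x u) (fderiv ℝ F x v)
      rw [hΦfix, ← hA, ← hA, hFx] at h1
      exact (hinner _ _).trans (h1.trans (hinner _ _).symm)) hsign
  have hzero : inner ℝ w (meanCurvatureVector (n := n) f x) = 0 := by
    simp only [meanCurvatureVector, inner_sum, real_inner_smul_right,
      inner_secondFundamentalForm hf (P.differentiableAt_fderiv x hx) hwN]
    exact htrace
  exact inner_self_eq_zero.1 hzero

end Helicoidal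

end

theorem theorem2 {n m : ℕ} {M : Type*} [TopologicalSpace M] [T2Space M]
    [ChartedSpace (EuclideanSpace ℝ (Fin n)) M] [IsManifold (𝓡 n) ∞ M]
    [Bundle.RiemannianBundle (fun p : M ↦ TangentSpace (𝓡 n) p)]
    [IsContMDiffRiemannianBundle (𝓡 n) ∞ (EuclideanSpace ℝ (Fin n))
      (fun p : M ↦ TangentSpace (𝓡 n) p)]
    (S : Set M) (hS : Helicoidal.IsHelicoidal (n := n) S m) :
    ∀ p ∈ Helicoidal.regularPart (n := n) S m, Helicoidal.IsMinimalAt (n := n) S m p := by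
  rintro p - P x hx rfl
  obtain ⟨W, -, hW⟩ := P.image_eq
  have hpS : P.toFun x ∈ S := by
    have : P.toFun x ∈ S ∩ W := hW ▸ Set.mem_image_of_mem _ hx
    exact this.1
  obtain ⟨φ, hφ, hφp, hφS, hneg⟩ := hS (P.toFun x) hpS
  exact Helicoidal.meanCurvatureVector_eq_zero_of_isometry P hx hφ hφp hφS (hneg P x hx rfl)
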